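/- **Setting.** $\|\cdot\|$ denotes the spectral norm of a matrix and $e_i$ the $i$-th standard basis vector. A matrix is called *orthonormal* if its columns are orthonormal. For $G\in\mathbb{R}^{n\times k}$ put $\rho(G)=\frac nk\max_{i}\|e_i^\top G\|_2^2$, and for an orthonormal matrix $X\in\mathbb{R}^{n\times k}$ let $\mu(X)=\frac nk\max_i\|e_i^\top X\|_2^2$ be its coherence. Let $\mathrm{QR}$ be any procedure that maps every $Y\in\mathbb{R}^{n\times k}$ to the orthonormal factor of a QR factorization of $Y$. For $Y\in\mathbb{R}^{n\times k}$ and $\epsilon,\mu>0$, the algorithm $\mathrm{SmoothQR}(Y,\epsilon,\mu)$ is: 1. $X'\leftarrow \mathrm{QR}(Y)$, $H\leftarrow 0$, $\sigma\leftarrow\epsilon\|Y\|/n$. 2. While $\mu(X')>\mu$ and $\sigma\le\|Y\|$: draw a fresh $H\in\mathbb{R}^{n\times k}$ with independent $N(0,\sigma^2/n)$ entries, set $X'\leftarrow\mathrm{QR}(Y+H)$, and then $\sigma\leftarrow2\sigma$. 3. Output $(X',H)$. A *step* is one execution of the body of the loop. **Lemma.** There are absolute constants $C,c,L,K>0$ such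 that the following holds for all $n,k$ with $k\log n\le c\,n$ (in particular, for all large $n$ if $k=o(n/\log n)$) and every $\tau\in(0,1)$. Let $A\in\mathbb{R}^{n\times n}$ be symmetric, let $U\in\mathbb{R}^{n\times k}$ be an orthonormal matrix whose columns are eigenvectors of $A$ (for instance the first $k$ eigenvectors), with $\mu(U)k\le n$, and let $N=(I-UU^\top)A$. Let $G\in\mathbb{R}^{n\times k}$, let $X\in\mathbb{R}^{n\times k}$ be orthonormal, and let $\nu>0$ satisfy $\nu\ge\max\{\|G\|,\|NX\|\}$. Let $\mu\le n$ satisfy $$\mu\ \ge\ \frac{C}{\tau^2}\Big(\mu(U)+\frac{\rho(G)+\rho(NX)}{\nu^2}+\log n\Big),$$ and let $\epsilon>0$ satisfy $\log(n/\epsilon)\le n$. Assume that the range of noise levels searched by the algorithm covers the scale $\tau\nu$, i.e. $$\frac{\epsilon\,\|AX+G\|}{n}\ \le\ \frac{\tau\nu}2\qquad\text{and}\qquad \tau\nu\le\|AX+G\| .$$ (If $\|AX+G\|\le n/2$, the first condition follows from $\epsilon\le\tau\nu$.) Then, with probability at least $1-K n^{-4}$, $\mathrm{SmoothQR}(AX+G,\epsilon,\mu)$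 terminates after at most $L\log(n/\epsilon)$ steps and outputs $(X',H)$ with $\mu(X')\le\mu$ and $\|H\|\le\tau\nu$. -/

import Mathlib

open MeasureTheory ProbabilityTheory

/-! `‖·‖` on matrices is the spectral norm (Euclidean operator norm) throughout. -/
open scoped Matrix Matrix.Norms.L2Operator

noncomputable section

namespace SmoothOrtho

/-- `X` has orthonormal columns. -/
def IsOrthonormalMatrix {n k : ℕ} (X : Matrix (Fin n) (Fin k) ℝ) : Prop :=
  Xᵀ * X = 1

/-- The coherence `μ(U) = max_i (n/k) ‖e_iᵀ U‖²` of an orthonormal matrix `U`. Since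
`‖e_iᵀ U‖ = ‖U Uᵀ e_i‖`, this is the coherence of the column space of `U`. -/
def coherence {n k : ℕ} (U : Matrix (Fin n) (Fin k) ℝ) : ℝ :=
  ⨆ i : Fin n, ((n : ℝ) / k) * ∑ j, U i j ^ 2

/-- The `ρ`-coherence `ρ(G) = (n/k) max_i ‖e_iᵀ G‖²` of an arbitrary matrix `G`. -/
def rho {n k : ℕ} (G : Matrix (Fin n) (Fin k) ℝ) : ℝ :=
  ((n : ℝ) / k) * ⨆ i : Fin n, ∑ j, G i j ^ 2

/-- `Q` is the orthonormal factor of some QR factorization `Y = Q R`, `R` upper triangular. -/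
def IsQRFactor {n k : ℕ} (Y Q : Matrix (Fin n) (Fin k) ℝ) : Prop :=
  IsOrthonormalMatrix Q ∧
    ∃ R : Matrix (Fin k) (Fin k) ℝ, (∀ i j, j < i → R i j = 0) ∧ Y = Q * R

/-- `qr` is an orthonormalization procedure: it maps every matrix `Y` to the orthonormal factor of
a QR factorization of `Y` (any one, where this factor is not unique). -/
def IsQRProcedure {n k : ℕ} (qr : Matrix (Fin n) (Fin k) ℝ → Matrix (Fin n) (Fin k) ℝ) : Prop :=
  ∀ Y, IsQRFactor Y (qr Y)

/-- The columns of `Y`, followed by zero vectors. -/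
def paddedCol {n k : ℕ} (Y : Matrix (Fin n) (Fin k) ℝ) (j : Fin n) : EuclideanSpace ℝ (Fin n) :=
  WithLp.toLp 2 fun i => if h : (j : ℕ) < k then Y i ⟨j, h⟩ else 0

/-- Gram-Schmidt orthonormalization of the columns of `Y`; where a column depends on the earlier
ones, some unit vector orthogonal to all the others is used. -/
def gramSchmidtMatrix {n k : ℕ} (hk : k ≤ n) (Y : Matrix (Fin n) (Fin k) ℝ) :
    Matrix (Fin n) (Fin k) ℝ :=
  fun i j => InnerProductSpace.gramSchmidtOrthonormalBasis (𝕜 := ℝ)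
    (E := EuclideanSpace ℝ (Fin n)) (by simp) (paddedCol Y) (Fin.castLE hk j) i

/-- Gram-Schmidt is an orthonormalization procedure, so such procedures exist. -/
theorem isQRProcedure_gramSchmidtMatrix {n k : ℕ} (hk : k ≤ n) :
    IsQRProcedure (gramSchmidtMatrix (n := n) (k := k) hk) := by
  intro Y
  set b := InnerProductSpace.gramSchmidtOrthonormalBasis (𝕜 := ℝ)
    (E := EuclideanSpace ℝ (Fin n)) (by simp) (paddedCol Y) with hb
  have hQ : ∀ i j, gramSchmidtMatrix hk Y i j = b (Fin.castLE hk j) i := fun i j => rfl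
  refine ⟨?_, Matrix.of fun i j => inner ℝ (b (Fin.castLE hk i))
    (paddedCol Y (Fin.castLE hk j)), ?_, ?_⟩
  · ext i j
    have h := (orthonormal_iff_ite.1 b.orthonormal) (Fin.castLE hk i) (Fin.castLE hk j)
    simp only [PiLp.inner_apply, RCLike.inner_apply, conj_trivial] at h
    simp only [Matrix.mul_apply, Matrix.transpose_apply, hQ, Matrix.one_apply]
    rw [Finset.sum_congr rfl fun x _ => mul_comm _ _, h]
    simp [Fin.ext_iff]
  · intro i j hij
    exact InnerProductSpace.gramSchmidtOrthonormalBasis_inv_triangular (𝕜 := ℝ)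
      (E := EuclideanSpace ℝ (Fin n)) (by simp) (paddedCol Y)
      (i := Fin.castLE hk j) (j := Fin.castLE hk i) hij
  · ext i j
    have h := congrArg (fun v : EuclideanSpace ℝ (Fin n) => v i)
      (b.sum_repr' (paddedCol Y (Fin.castLE hk j)))
    have hl : paddedCol Y (Fin.castLE hk j) i = Y i j := by simp [paddedCol]
    simp only [hl, WithLp.ofLp_sum, WithLp.ofLp_smul, Finset.sum_apply, Pi.smul_apply,
      smul_eq_mul] at h
    rw [← h, Matrix.mul_apply]
    symm
    refine Finset.sum_of_injOn (Fin.castLE hk) (Fin.castLE_injective hk).injOn (by simp) ?_ ?_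
    · intro a _ ha
      have hja : Fin.castLE hk j < a := by
        by_contra hcon
        apply ha
        have : (a : ℕ) < k := lt_of_le_of_lt (Fin.le_def.1 (not_lt.1 hcon)) j.2
        exact ⟨⟨a, this⟩, by simp, by simp⟩
      rw [InnerProductSpace.gramSchmidtOrthonormalBasis_inv_triangular (𝕜 := ℝ) _ _ hja, zero_mul]
    · intro a _
      rw [hQ, Matrix.of_apply, mul_comm]

/-- The variables `X`, `H`, `σ` of the algorithm. -/
structure State (n k : ℕ) where
  /-- current orthonormal matrix -/
  X : Matrix (Fin n) (Fin k) ℝ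
  /-- most recently added noise -/
  H : Matrix (Fin n) (Fin k) ℝ
  /-- current noise level -/
  σ : ℝ

/-- Step 1: `X ← QR(Y)`, `H ← 0`, `σ ← ε ‖Y‖ / n`. -/
def initState {n k : ℕ} (qr : Matrix (Fin n) (Fin k) ℝ → Matrix (Fin n) (Fin k) ℝ)
    (Y : Matrix (Fin n) (Fin k) ℝ) (ε : ℝ) : State n k :=
  ⟨qr Y, 0, ε * ‖Y‖ / n⟩

/-- The guard of the while loop: `μ(X) > μ` and `σ ≤ ‖Y‖`. -/
def Guard {n k : ℕ} (Y : Matrix (Fin n) (Fin k) ℝ) (μ : ℝ) (s : State n k) : Prop :=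
  μ < coherence s.X ∧ s.σ ≤ ‖Y‖

/-- The body of the while loop: `X ← GS(Y + H)` and `σ ← 2σ`, where `H = (σ/√n) Z`. For `Z` with
independent standard Gaussian entries, `H` has independent entries of law `N(0, σ²/n)`. -/
def loopBody {n k : ℕ} (qr : Matrix (Fin n) (Fin k) ℝ → Matrix (Fin n) (Fin k) ℝ)
    (Y Z : Matrix (Fin n) (Fin k) ℝ) (s : State n k) : State n k :=
  ⟨qr (Y + (s.σ / √n) • Z), (s.σ / √n) • Z, 2 * s.σ⟩

/-- The state after `t` executions of the loop body, execution `t` using the fresh sample `Z t`. -/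
def stateAfter {n k : ℕ} (qr : Matrix (Fin n) (Fin k) ℝ → Matrix (Fin n) (Fin k) ℝ)
    (Y : Matrix (Fin n) (Fin k) ℝ) (ε : ℝ) (Z : ℕ → Matrix (Fin n) (Fin k) ℝ) : ℕ → State n k
  | 0 => initState qr Y ε
  | t + 1 => loopBody qr Y (Z t) (stateAfter qr Y ε Z t)

/-- `SmoothQR(Y, ε, μ)`, run with the noise samples `Z`, terminates after exactly `T` executions of
the loop body and outputs the pair `(X', H)`. -/
def SmoothQROutputs {n k : ℕ} (qr : Matrix (Fin n) (Fin k) ℝ → Matrix (Fin n) (Fin k) ℝ)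
    (Y : Matrix (Fin n) (Fin k) ℝ) (ε μ : ℝ) (Z : ℕ → Matrix (Fin n) (Fin k) ℝ)
    (T : ℕ) (X' H : Matrix (Fin n) (Fin k) ℝ) : Prop :=
  (∀ t < T, Guard Y μ (stateAfter qr Y ε Z t)) ∧
    ¬ Guard Y μ (stateAfter qr Y ε Z T) ∧
    X' = (stateAfter qr Y ε Z T).X ∧ H = (stateAfter qr Y ε Z T).H

/-- `Z 0, Z 1, …` are random matrices all of whose entries are independent standard Gaussians. -/
def IsGaussianSamples {Ω : Type*} [MeasurableSpace Ω] (P : Measure Ω) {n k : ℕ}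
    (Z : ℕ → Ω → Matrix (Fin n) (Fin k) ℝ) : Prop :=
  (∀ t i j, HasLaw (fun ω => Z t ω i j) (gaussianReal 0 1) P) ∧
    iIndepFun (fun (p : ℕ × Fin n × Fin k) (ω : Ω) => Z p.1 ω p.2.1 p.2.2) P

end SmoothOrtho

end

noncomputable section

namespace SmoothOrtho

/-! Write P = UUᵀ and Y = AX + G. The noise levels double, so some step `s` has level σ in (τν/4,
τν/2]. If every sample up to step `s` satisfies ‖Z‖ ≤ 2√n, then every noise matrix so far has norm
at most 2σ ≤ τν. An earlier stop is then harmless, and it remains to bound the coherence reached at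
step `s` (`exists_smoothQROutputs`).

Projecting away from U gives W' = (I - P)(Y + H) = NX + (I - P)(G + H), so the possibly large part
PAX disappears. If the least singular value of W' is at least σ/8, then row i of the QR factor has
norm at most ‖e_iᵀU‖ + (8/σ)‖e_iᵀW'‖ (`IsQRFactor.eucNorm_row_le`). The rows of W' are controlled by
ρ(NX), ρ(G), a chi-square tail for the rows of H, and ‖e_iᵀU‖‖G + H‖. As σ is comparable to τν, this
yields the required μ (`coherence_qr_le`).

The singular value bound is a net argument (`gaussianRows_eucNorm_lower`). The coordinates of (I -
P)Zx are dependent, so the correction UᵀZx is itself replaced by n times a grid point w, and the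
union bound runs over pairs (y, w). For a fixed pair the coordinates are independent Gaussians with
arbitrary shifts, and the small-ball bound exp(-n/5) beats the exp(6n/100) pairs allowed by k log n
≤ n/100.

Norm failures are summed over the at most 2n steps, row failures over the n rows. Independence
between steps is never needed. -/

/-- The law of an `n × k` matrix with independent standard Gaussian entries. -/
def gaussianRows (n k : ℕ) : Measure (Fin n → Fin k → ℝ) :=
  Measure.pi fun _ => Measure.pi fun _ => gaussianReal 0 1

instance (n k : ℕ) : IsProbabilityMeasure (gaussianRows n k) := by
  unfold gaussianRows; infer_instance

/-! ### Gaussian exponential moments and Chernoff bounds -/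

/-- The integral equals (1 - v/2)^(-1/2), which increases with v. Variance 0 is separate because
there is no density. -/
theorem lintegral_exp_sq_gaussianReal_le {v : NNReal} (hv : v ≤ 1) :
    ∫⁻ x, ENNReal.ofReal (Real.exp (x ^ 2 / 4)) ∂gaussianReal 0 v ≤ ENNReal.ofReal (√2) := by
  rcases eq_or_ne v 0 with rfl | h0
  · rw [gaussianReal_zero_var, lintegral_dirac' _ (by fun_prop)]
    exact ENNReal.ofReal_le_ofReal (by simp [Real.one_le_sqrt])
  have hv0 : 0 < (v : ℝ) := by positivity
  have hv1 : (v : ℝ) ≤ 1 := hv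
  rw [gaussianReal_of_var_ne_zero _ h0,
    lintegral_withDensity_eq_lintegral_mul _ (measurable_gaussianPDF _ _) (by fun_prop)]
  have hb : 0 < 1 / (2 * (v : ℝ)) - 1 / 4 := by
    rw [sub_pos, div_lt_div_iff₀ (by norm_num) (by positivity)]; linarith
  have key : ∀ x : ℝ, (gaussianPDF 0 v * fun x => ENNReal.ofReal (Real.exp (x ^ 2 / 4))) x =
      ENNReal.ofReal ((√(2 * Real.pi * v))⁻¹ *
        Real.exp (-(1 / (2 * (v : ℝ)) - 1 / 4) * x ^ 2)) := by
    intro x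
    rw [Pi.mul_apply, gaussianPDF, ← ENNReal.ofReal_mul (gaussianPDFReal_nonneg _ _ _),
      gaussianPDFReal, mul_assoc, ← Real.exp_add]
    congr 3
    field_simp
    ring
  simp_rw [key]
  rw [← ofReal_integral_eq_lintegral_ofReal
    ((integrable_exp_neg_mul_sq hb).const_mul _) (ae_of_all _ fun x => by positivity),
    integral_const_mul, integral_gaussian]
  refine ENNReal.ofReal_le_ofReal ?_
  rw [← Real.sqrt_inv, ← Real.sqrt_mul (by positivity)]
  refine Real.sqrt_le_sqrt ?_
  have : (2 * Real.pi * (v : ℝ))⁻¹ * (Real.pi / (1 / (2 * (v : ℝ)) - 1 / 4)) =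
      1 / (1 - v / 2) := by
    have h2 : (4 - 2 * (v : ℝ)) ≠ 0 := by linarith
    have h3 : (1 - (v : ℝ) / 2) ≠ 0 := by linarith
    have h4 := hb.ne'
    have h5 := Real.pi_ne_zero
    rw [inv_mul_eq_div, div_div, div_eq_div_iff (by positivity) h3]
    field_simp
    ring
  rw [this, div_le_iff₀ (by linarith)]
  linarith

/-- Only the height of the density matters: it is at most (π/2)^(-1/2) when v ≥ 1/4. Translation
invariance of Lebesgue measure then removes b, so the bound is uniform in the shift. -/
theorem lintegral_exp_neg_sq_gaussianReal_le {v : NNReal} (hv : 1 / 4 ≤ (v : ℝ)) (b : ℝ) :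
    ∫⁻ x, ENNReal.ofReal (Real.exp (-(32 * (b + x) ^ 2))) ∂gaussianReal 0 v ≤
      ENNReal.ofReal (1 / 4) := by
  have h0 : v ≠ 0 := by rintro rfl; norm_num at hv
  rw [gaussianReal_of_var_ne_zero _ h0,
    lintegral_withDensity_eq_lintegral_mul _ (measurable_gaussianPDF _ _) (by fun_prop)]
  have key : ∀ x : ℝ, (gaussianPDF 0 v * fun x => ENNReal.ofReal (Real.exp (-(32 * (b + x) ^ 2)))) x
      ≤ ENNReal.ofReal ((√(Real.pi / 2))⁻¹ * Real.exp (-32 * (b + x) ^ 2)) := by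
    intro x
    rw [Pi.mul_apply, gaussianPDF, ← ENNReal.ofReal_mul (gaussianPDFReal_nonneg _ _ _)]
    refine ENNReal.ofReal_le_ofReal ?_
    rw [neg_mul]
    refine mul_le_mul_of_nonneg_right ?_ (Real.exp_pos _).le
    rw [gaussianPDFReal]
    calc _ ≤ (√(2 * Real.pi * v))⁻¹ * 1 := by
          refine mul_le_mul_of_nonneg_left (Real.exp_le_one_iff.2 ?_) (by positivity)
          exact div_nonpos_of_nonpos_of_nonneg (by nlinarith [sq_nonneg (x - 0)]) (by positivity)
      _ ≤ _ := by
          rw [mul_one]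
          refine inv_anti₀ (by positivity) (Real.sqrt_le_sqrt ?_)
          nlinarith [Real.pi_pos]
  refine (lintegral_mono key).trans ?_
  rw [lintegral_add_left_eq_self (μ := volume)
    (fun x => ENNReal.ofReal ((√(Real.pi / 2))⁻¹ * Real.exp (-32 * x ^ 2))) b]
  rw [← ofReal_integral_eq_lintegral_ofReal
    ((integrable_exp_neg_mul_sq (by norm_num)).const_mul _) (ae_of_all _ fun x => by positivity),
    integral_const_mul, integral_gaussian]
  refine ENNReal.ofReal_le_ofReal ?_
  rw [← Real.sqrt_inv, ← Real.sqrt_mul (by positivity)]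
  refine Real.sqrt_le_iff.2 ⟨by norm_num, le_of_eq ?_⟩
  have h5 := Real.pi_ne_zero
  field_simp
  norm_num

theorem map_dotProduct_pi_gaussianReal {k : ℕ} (y : Fin k → ℝ) :
    (Measure.pi fun _ : Fin k => gaussianReal 0 1).map (fun x => ∑ j, x j * y j) =
      gaussianReal 0 (∑ j, y j ^ 2).toNNReal := by
  refine Measure.ext_of_charFun ?_
  have hm : ∀ j, Measurable fun x : Fin k → ℝ => x j * y j := fun j => by fun_prop
  have hind : iIndepFun (fun (j : Fin k) (x : Fin k → ℝ) => x j * y j)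
      (Measure.pi fun _ : Fin k => gaussianReal 0 1) :=
    iIndepFun_pi (μ := fun _ : Fin k => gaussianReal 0 1) (X := fun j x => x * y j)
      (fun j => by fun_prop)
  rw [hind.charFun_map_fun_sum_eq_prod (fun j => (hm j).aemeasurable)]
  ext t
  have hl : ∀ j, (Measure.pi fun _ : Fin k => gaussianReal 0 1).map (fun x => x j * y j) =
      gaussianReal 0 (y j ^ 2).toNNReal := by
    intro j
    have := gaussianReal_mul_const (P := Measure.pi fun _ : Fin k => gaussianReal 0 1)
      (X := fun x => x j) (μ := 0) (v := 1)
      ⟨(measurable_pi_apply j).aemeasurable, (measurePreserving_eval (fun _ : Fin k => gaussianReal 0 1) j).map_eq⟩ (y j)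
    rw [this.map_eq]
    congr 1
    · simp
    · ext; simp [sq_nonneg]
  simp only [Finset.prod_apply, hl, charFun_gaussianReal]
  rw [← Complex.exp_sum]
  congr 1
  rw [Real.coe_toNNReal _ (Finset.sum_nonneg fun j _ => sq_nonneg _)]
  simp only [Real.coe_toNNReal _ (sq_nonneg _)]
  push_cast
  simp [Finset.sum_div, Finset.sum_mul]

/-- Markov's inequality for ∏ exp(φ i (Z i)), whose expectation factors. The function depends on i
so that each coordinate can carry its own shift. -/
theorem pi_chernoff {ι E : Type*} [Fintype ι] [MeasurableSpace E] (ρ : Measure E)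
    [IsProbabilityMeasure ρ] (φ : ι → E → ℝ) (hφ : ∀ i, Measurable (φ i)) {R : ℝ} (hR : 0 ≤ R)
    (h : ∀ i, ∫⁻ z, ENNReal.ofReal (Real.exp (φ i z)) ∂ρ ≤ ENNReal.ofReal R) (a : ℝ) :
    Measure.pi (fun _ : ι => ρ) {Z | a ≤ ∑ i, φ i (Z i)} ≤
      ENNReal.ofReal (Real.exp (-a) * R ^ Fintype.card ι) := by
  have hind : iIndepFun (fun (i : ι) (Z : ι → E) => ENNReal.ofReal (Real.exp (φ i (Z i))))
      (Measure.pi fun _ : ι => ρ) :=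
    iIndepFun_pi (μ := fun _ : ι => ρ) (X := fun i z => ENNReal.ofReal (Real.exp (φ i z)))
      (fun i => by fun_prop)
  have hm : ∀ i, Measurable fun Z : ι → E => ENNReal.ofReal (Real.exp (φ i (Z i))) :=
    fun i => by fun_prop
  have hprod := lintegral_prod_eq_prod_lintegral_of_indepFun Finset.univ _ hind
    hm
  have hle : ∫⁻ Z, ∏ i, ENNReal.ofReal (Real.exp (φ i (Z i))) ∂Measure.pi (fun _ : ι => ρ) ≤
      ENNReal.ofReal R ^ Fintype.card ι := by
    rw [hprod]
    refine Finset.prod_le_pow_card _ _ _ fun i _ => ?_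
    rw [(measurePreserving_eval (fun _ : ι => ρ) i).lintegral_comp
      (f := fun z => ENNReal.ofReal (Real.exp (φ i z))) (by fun_prop)]
    exact h i
  have hmk := mul_meas_ge_le_lintegral₀ (μ := Measure.pi fun _ : ι => ρ)
    (f := fun Z => ∏ i, ENNReal.ofReal (Real.exp (φ i (Z i))))
    (Finset.aemeasurable_fun_prod _ fun i _ => (hm i).aemeasurable)
    (ENNReal.ofReal (Real.exp a))
  have hsub : {Z : ι → E | a ≤ ∑ i, φ i (Z i)} ⊆
      {Z | ENNReal.ofReal (Real.exp a) ≤ ∏ i, ENNReal.ofReal (Real.exp (φ i (Z i)))} := by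
    intro Z hZ
    rw [Set.mem_ofPred_eq, ← ENNReal.ofReal_prod_of_nonneg fun i _ => (Real.exp_pos _).le,
      ← Real.exp_sum]
    exact ENNReal.ofReal_le_ofReal (Real.exp_le_exp.2 hZ)
  refine (measure_mono hsub).trans ?_
  rw [ENNReal.ofReal_mul (Real.exp_pos _).le, ENNReal.ofReal_pow hR, Real.exp_neg,
    ENNReal.ofReal_inv_of_pos (Real.exp_pos _), mul_comm, ← div_eq_mul_inv]
  rw [ENNReal.le_div_iff_mul_le (by simp [Real.exp_pos]) (by simp), mul_comm]
  exact hmk.trans hle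

theorem gaussianRows_mulVec_tail {n k : ℕ} {y : Fin k → ℝ} (hy : ∑ j, y j ^ 2 ≤ 1) :
    gaussianRows n k {Z | 9 / 4 * n ≤ ∑ i, (∑ j, Z i j * y j) ^ 2} ≤
      ENNReal.ofReal (Real.exp (-n / 5)) := by
  have h := pi_chernoff (ι := Fin n) (Measure.pi fun _ : Fin k => gaussianReal 0 1)
    (fun _ z => (∑ j, z j * y j) ^ 2 / 4) (fun _ => by fun_prop) (R := √2) (by positivity) ?_
    (9 / 16 * n)
  · refine (measure_mono ?_).trans (h.trans (ENNReal.ofReal_le_ofReal ?_))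
    · intro Z hZ
      rw [Set.mem_ofPred_eq] at hZ
      rw [Set.mem_ofPred_eq, ← Finset.sum_div]
      linarith
    -- The value 29/80 exceeds (log 2)/2 and satisfies 9/16 - 29/80 = 1/5.
    · have h2 : √2 ≤ Real.exp (29 / 80) := by
        refine Real.sqrt_le_iff.2 ⟨by positivity, ?_⟩
        rw [← Real.exp_nat_mul]
        have := Real.quadratic_le_exp_of_nonneg (x := (2 : ℕ) * (29 / 80 : ℝ)) (by norm_num)
        have h3 := Real.exp_one_gt_d9
        rw [← Real.log_le_iff_le_exp (by norm_num)]
        have := Real.log_two_lt_d9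
        norm_num
        linarith
      calc _ ≤ Real.exp (-(9 / 16 * n)) * Real.exp (29 / 80) ^ n := by
            rw [Fintype.card_fin]; gcongr
        _ = _ := by rw [← Real.exp_nat_mul, ← Real.exp_add]; congr 1; ring
  · intro i
    rw [← lintegral_map (f := fun x : ℝ => ENNReal.ofReal (Real.exp (x ^ 2 / 4)))
      (g := fun z : Fin k → ℝ => ∑ j, z j * y j) (by fun_prop) (by fun_prop),
      map_dotProduct_pi_gaussianReal]
    exact lintegral_exp_sq_gaussianReal_le (by simpa using hy)

theorem gaussianRows_small_ball {n k : ℕ} {y : Fin k → ℝ} (hy : 1 / 4 ≤ ∑ j, y j ^ 2)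
    (b : Fin n → ℝ) :
    gaussianRows n k {Z | ∑ i, (b i + ∑ j, Z i j * y j) ^ 2 ≤ n / 32} ≤
      ENNReal.ofReal (Real.exp (-n / 5)) := by
  have h := pi_chernoff (ι := Fin n) (Measure.pi fun _ : Fin k => gaussianReal 0 1)
    (fun i z => -(32 * (b i + ∑ j, z j * y j) ^ 2)) (fun _ => by fun_prop) (R := 1 / 4)
    (by positivity) ?_ (-n)
  · refine (measure_mono ?_).trans (h.trans (ENNReal.ofReal_le_ofReal ?_))
    · intro Z hZ
      rw [Set.mem_ofPred_eq] at hZ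
      rw [Set.mem_ofPred_eq, Finset.sum_neg_distrib, ← Finset.mul_sum]
      linarith
    · have h2 : (1 / 4 : ℝ) ≤ Real.exp (-(6 / 5)) := by
        rw [← Real.log_le_iff_le_exp (by norm_num), one_div, Real.log_inv,
          show (4 : ℝ) = 2 ^ 2 by norm_num, Real.log_pow]
        have := Real.log_two_gt_d9
        push_cast
        linarith
      calc _ ≤ Real.exp (-(-n)) * Real.exp (-(6 / 5)) ^ n := by
            rw [Fintype.card_fin]; gcongr
        _ = _ := by rw [← Real.exp_nat_mul, ← Real.exp_add]; congr 1; ring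
  · intro i
    rw [← lintegral_map (f := fun x : ℝ => ENNReal.ofReal (Real.exp (-(32 * (b i + x) ^ 2))))
      (g := fun z : Fin k → ℝ => ∑ j, z j * y j) (by fun_prop) (by fun_prop),
      map_dotProduct_pi_gaussianReal]
    refine lintegral_exp_neg_sq_gaussianReal_le ?_ _
    rwa [Real.coe_toNNReal _ (Finset.sum_nonneg fun j _ => sq_nonneg _)]

/-- After multiplication by 1/4, the term 2k absorbs the factor √2 ^ k, and 20 log n leaves n⁻⁵,
hence n⁻⁴ after a union over rows. -/
theorem gaussianRows_row_tail {n k : ℕ} (i : Fin n) :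
    gaussianRows n k {Z | 2 * k + 20 * Real.log n ≤ ∑ j, Z i j ^ 2} ≤
      ENNReal.ofReal (((n : ℝ) ^ 5)⁻¹) := by
  have hn : 0 < (n : ℝ) := by exact_mod_cast i.pos
  have h := pi_chernoff (ι := Fin k) (gaussianReal 0 1)
    (fun _ x => x ^ 2 / 4) (fun _ => by fun_prop) (R := √2) (by positivity)
    (fun _ => lintegral_exp_sq_gaussianReal_le le_rfl) (k / 2 + 5 * Real.log n)
  have hmp := measurePreserving_eval
    (fun _ : Fin n => Measure.pi fun _ : Fin k => gaussianReal 0 1) i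
  have hms : MeasurableSet {z : Fin k → ℝ | k / 2 + 5 * Real.log n ≤ ∑ j, z j ^ 2 / 4} :=
    measurableSet_le (by fun_prop) (by fun_prop)
  rw [← hmp.measure_preimage hms.nullMeasurableSet] at h
  refine (measure_mono ?_).trans (h.trans (ENNReal.ofReal_le_ofReal ?_))
  · intro Z hZ
    rw [Set.mem_ofPred_eq] at hZ
    simp only [Set.mem_preimage, Set.mem_ofPred_eq, Function.eval, ← Finset.sum_div]
    linarith
  · have h2 : √2 ≤ Real.exp (1 / 2) := by
      refine Real.sqrt_le_iff.2 ⟨by positivity, ?_⟩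
      rw [← Real.exp_nat_mul, ← Real.log_le_iff_le_exp (by norm_num)]
      have := Real.log_two_lt_d9
      norm_num
      linarith
    calc _ ≤ Real.exp (-(k / 2 + 5 * Real.log n)) * Real.exp (1 / 2) ^ k := by
          rw [Fintype.card_fin]; gcongr
      _ = Real.exp (-(5 * Real.log n)) := by
          rw [← Real.exp_nat_mul, ← Real.exp_add]; congr 1; ring
      _ = _ := by
          rw [Real.exp_neg, mul_comm, Real.exp_mul, Real.exp_log hn]
          norm_cast

/-! ### The law of one noise sample -/

/-- Independence of the samples is indexed by flat tuples, while `gaussianRows` is an iterated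
product. Both have the same flattened law, and currying transports the equality back. -/
theorem hasLaw_gaussianRows {Ω : Type*} [MeasurableSpace Ω] {P : Measure Ω}
    [IsProbabilityMeasure P] {n k : ℕ} {Z : ℕ → Ω → Matrix (Fin n) (Fin k) ℝ}
    (hZ : IsGaussianSamples P Z) (t : ℕ) :
    HasLaw (fun ω i j => Z t ω i j) (gaussianRows n k) P := by
  have h1 : HasLaw (fun ω (p : Fin n × Fin k) => Z t ω p.1 p.2)
      (Measure.pi fun _ => gaussianReal 0 1) P :=
    (hZ.2.precomp (g := fun p : Fin n × Fin k => (t, p.1, p.2))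
      (fun p q h => by simpa [Prod.ext_iff] using h)).hasLaw_pi fun p => hZ.1 t p.1 p.2
  have hmarg : ∀ (i : Fin n) (j : Fin k),
      HasLaw (fun M : Fin n → Fin k → ℝ => M i j) (gaussianReal 0 1) (gaussianRows n k) :=
    fun i j => ((measurePreserving_eval (fun _ : Fin k => gaussianReal 0 1) j).comp
      (measurePreserving_eval
        (fun _ : Fin n => Measure.pi fun _ : Fin k => gaussianReal 0 1) i)).hasLaw
  have h2 : iIndepFun (fun (p : Fin n × Fin k) (M : Fin n → Fin k → ℝ) => M p.1 p.2)
      (gaussianRows n k) := by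
    refine iIndepFun_uncurry' (X := fun i j (M : Fin n → Fin k → ℝ) => M i j)
      (fun i j => by fun_prop) ?_ fun i => ?_
    · exact iIndepFun_pi (μ := fun _ : Fin n => Measure.pi fun _ : Fin k => gaussianReal 0 1)
        (X := fun i x => x) (fun j => by fun_prop)
    · rw [iIndepFun_iff_hasLaw_pi_pi (hmarg i)]
      exact (measurePreserving_eval
        (fun _ : Fin n => Measure.pi fun _ : Fin k => gaussianReal 0 1) i).hasLaw
  have h3 := h2.hasLaw_pi (μ := fun _ => gaussianReal 0 1) fun p : Fin n × Fin k => hmarg p.1 p.2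
  refine ⟨aemeasurable_pi_iff.2 fun i => aemeasurable_pi_iff.2 fun j => (hZ.1 t i j).aemeasurable,
    ?_⟩
  have hc : Measurable fun (x : Fin n × Fin k → ℝ) (i : Fin n) (j : Fin k) => x (i, j) := by
    fun_prop
  have h4 := h1.map_eq.trans h3.map_eq.symm
  have h5 := congrArg (Measure.map fun (x : Fin n × Fin k → ℝ) (i : Fin n) (j : Fin k) => x (i, j))
    h4
  rw [AEMeasurable.map_map_of_aemeasurable hc.aemeasurable h1.aemeasurable,
    AEMeasurable.map_map_of_aemeasurable hc.aemeasurable h3.aemeasurable] at h5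
  exact h5.trans Measure.map_id

/-! ### Euclidean norms and orthonormal matrices -/

/-- The Euclidean norm of a coordinate vector. -/
def eucNorm {ι : Type*} [Fintype ι] (v : ι → ℝ) : ℝ := ‖WithLp.toLp 2 v‖

section eucNorm

variable {ι κ : Type*} [Fintype ι] [Fintype κ]

theorem eucNorm_nonneg (v : ι → ℝ) : 0 ≤ eucNorm v := norm_nonneg _

theorem eucNorm_sq (v : ι → ℝ) : eucNorm v ^ 2 = ∑ i, v i ^ 2 := by
  simp [eucNorm, EuclideanSpace.norm_sq_eq]

theorem eucNorm_add_le (v w : ι → ℝ) : eucNorm (v + w) ≤ eucNorm v + eucNorm w := by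
  simpa [eucNorm] using norm_add_le (WithLp.toLp 2 v) (WithLp.toLp 2 w)

theorem eucNorm_sub_le (v w : ι → ℝ) : eucNorm (v - w) ≤ eucNorm v + eucNorm w := by
  simpa [eucNorm] using norm_sub_le (WithLp.toLp 2 v) (WithLp.toLp 2 w)

theorem eucNorm_smul (c : ℝ) (v : ι → ℝ) : eucNorm (c • v) = |c| * eucNorm v := by
  simp [eucNorm, norm_smul]

theorem abs_dotProduct_le (v w : ι → ℝ) : |v ⬝ᵥ w| ≤ eucNorm v * eucNorm w := by
  refine abs_le_of_sq_le_sq ?_ (mul_nonneg (eucNorm_nonneg _) (eucNorm_nonneg _))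
  rw [mul_pow, eucNorm_sq, eucNorm_sq]
  exact Finset.sum_mul_sq_le_sq_mul_sq _ _ _

theorem dotProduct_self_eq (v : ι → ℝ) : v ⬝ᵥ v = eucNorm v ^ 2 := by
  rw [eucNorm_sq]; exact Finset.sum_congr rfl fun i _ => (sq _).symm

theorem eucNorm_mulVec_le [DecidableEq κ] (A : Matrix ι κ ℝ) (x : κ → ℝ) :
    eucNorm (A *ᵥ x) ≤ ‖A‖ * eucNorm x :=
  A.l2_opNorm_mulVec (WithLp.toLp 2 x)

theorem opNorm_le_of_unit [DecidableEq κ] {A : Matrix ι κ ℝ} {C : ℝ} (hC : 0 ≤ C)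
    (h : ∀ x, eucNorm x = 1 → eucNorm (A *ᵥ x) ≤ C) : ‖A‖ ≤ C :=
  ContinuousLinearMap.opNorm_le_of_unit_norm (𝕜 := ℝ) hC fun x hx => h x.ofLp hx

end eucNorm

theorem IsOrthonormalMatrix.eucNorm_mulVec {n k : ℕ} {U : Matrix (Fin n) (Fin k) ℝ}
    (hU : IsOrthonormalMatrix U) (x : Fin k → ℝ) : eucNorm (U *ᵥ x) = eucNorm x := by
  rw [← sq_eq_sq₀ (eucNorm_nonneg _) (eucNorm_nonneg _), ← dotProduct_self_eq,
    ← dotProduct_self_eq, Matrix.dotProduct_mulVec, Matrix.vecMul_mulVec,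
    show Uᵀ * U = 1 from hU, Matrix.vecMul_one]

theorem IsOrthonormalMatrix.eucNorm_transpose_mulVec_le {n k : ℕ} {U : Matrix (Fin n) (Fin k) ℝ}
    (hU : IsOrthonormalMatrix U) (v : Fin n → ℝ) : eucNorm (Uᵀ *ᵥ v) ≤ eucNorm v := by
  have h1 : eucNorm (Uᵀ *ᵥ v) ^ 2 = v ⬝ᵥ (U *ᵥ (Uᵀ *ᵥ v)) := by
    rw [← dotProduct_self_eq, Matrix.dotProduct_mulVec, Matrix.vecMul_transpose,
      dotProduct_comm]
  have h2 := (le_abs_self _).trans (abs_dotProduct_le v (U *ᵥ (Uᵀ *ᵥ v)))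
  rw [hU.eucNorm_mulVec, ← h1] at h2
  rcases (eucNorm_nonneg (Uᵀ *ᵥ v)).eq_or_lt with h | h
  · rw [← h]; exact eucNorm_nonneg _
  · nlinarith

/-! ### Grid nets and extreme singular values -/

/-- The points of the cube `[-1, 1]^k` with coordinates in `(1 / m) ℤ`. -/
def gridPoints (k m : ℕ) : Finset (Fin k → ℝ) :=
  (Fintype.piFinset fun _ => Finset.Icc (-m : ℤ) m).image fun a j => (a j : ℝ) / m

theorem card_gridPoints_le (k m : ℕ) : (gridPoints k m).card ≤ (2 * m + 1) ^ k := by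
  refine Finset.card_image_le.trans ?_
  rw [Fintype.card_piFinset]
  simp only [Int.card_Icc, Finset.prod_const, Finset.card_univ, Fintype.card_fin]
  exact le_of_eq (by congr 1; omega)

/-- Rounding towards zero, rather than to the nearest point, keeps grid approximants inside the unit
ball. -/
theorem exists_int_div_near {m : ℕ} (hm : 0 < m) {x : ℝ} (hx : |x| ≤ 1) :
    ∃ a ∈ Finset.Icc (-m : ℤ) m, |(a : ℝ) / m| ≤ |x| ∧ |x - a / m| ≤ 1 / m := by
  have hm' : (0 : ℝ) < m := by exact_mod_cast hm
  obtain ⟨a, h1, h2⟩ : ∃ a : ℤ, |(a : ℝ)| ≤ |x * m| ∧ |x * m - a| ≤ 1 := by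
    rcases le_total 0 (x * m) with h | h
    · refine ⟨⌊x * m⌋, ?_, ?_⟩
      · rw [abs_of_nonneg h, abs_of_nonneg (by exact_mod_cast Int.floor_nonneg.2 h)]
        exact Int.floor_le _
      · have h3 := Int.floor_le (x * m)
        have h4 := Int.lt_floor_add_one (x * m)
        rw [abs_le]; constructor <;> linarith
    · refine ⟨⌈x * m⌉, ?_, ?_⟩
      · have : (⌈x * m⌉ : ℝ) ≤ 0 := by exact_mod_cast Int.ceil_le.2 (by simpa using h)
        rw [abs_of_nonpos h, abs_of_nonpos this]
        exact neg_le_neg (Int.le_ceil _)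
      · have h3 := Int.le_ceil (x * m)
        have h4 := Int.ceil_lt_add_one (x * m)
        rw [abs_le]; constructor <;> linarith
  have h3 : |(a : ℝ) / m| ≤ |x| := by
    rw [abs_div, abs_of_pos hm', div_le_iff₀ hm']
    rwa [abs_mul, abs_of_pos hm'] at h1
  refine ⟨a, ?_, h3, ?_⟩
  · have h4 : |(a : ℝ)| ≤ m := by
      have := h3.trans hx
      rwa [abs_div, abs_of_pos hm', div_le_one hm'] at this
    rw [abs_le] at h4
    rw [Finset.mem_Icc]
    exact ⟨by exact_mod_cast h4.1, by exact_mod_cast h4.2⟩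
  · have : x - a / m = (x * m - a) / m := by field_simp
    rw [this, abs_div, abs_of_pos hm']
    gcongr

theorem exists_gridPoints_near {k m : ℕ} (hm : 0 < m) {x : Fin k → ℝ} (hx : eucNorm x ≤ 1) :
    ∃ y ∈ gridPoints k m, eucNorm y ≤ 1 ∧ eucNorm (x - y) ≤ √k / m := by
  have hx2 : ∑ i, x i ^ 2 ≤ 1 := by
    rw [← eucNorm_sq]; exact pow_le_one₀ (eucNorm_nonneg _) hx
  have hx' : ∀ j, |x j| ≤ 1 := by
    intro j
    rw [← sq_le_one_iff_abs_le_one]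
    exact (Finset.single_le_sum (f := fun i => x i ^ 2) (fun i _ => sq_nonneg _)
      (Finset.mem_univ j)).trans hx2
  choose a ha h1 h2 using fun j => exists_int_div_near hm (hx' j)
  refine ⟨fun j => (a j : ℝ) / m, Finset.mem_image.2 ⟨a, Fintype.mem_piFinset.2 ha, rfl⟩, ?_, ?_⟩
  · rw [← sq_le_one_iff₀ (eucNorm_nonneg _), eucNorm_sq]
    exact (Finset.sum_le_sum fun j _ => sq_le_sq.2 (h1 j)).trans hx2
  · rw [← sq_le_sq₀ (eucNorm_nonneg _) (by positivity), eucNorm_sq, div_pow,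
      Real.sq_sqrt (by positivity)]
    calc ∑ j, (x - fun j => (a j : ℝ) / m) j ^ 2 ≤ ∑ _j : Fin k, (1 / m : ℝ) ^ 2 :=
          Finset.sum_le_sum fun j _ => sq_le_sq.2 ((h2 j).trans (le_abs_self _))
      _ = _ := by simp [div_eq_mul_inv]

theorem opNorm_le_of_gridPoints {n k m : ℕ} (hm : 0 < m) (hkm : √k / m ≤ 1 / 4)
    {Z : Matrix (Fin n) (Fin k) ℝ}
    (h : ∀ y ∈ gridPoints k m, eucNorm y ≤ 1 → eucNorm (Z *ᵥ y) ≤ 3 / 2 * √n) :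
    ‖Z‖ ≤ 2 * √n := by
  -- The approximation error is charged to ‖Z‖ itself and absorbed on the left.
  suffices h2 : ‖Z‖ ≤ 3 / 2 * √n + ‖Z‖ * (1 / 4) by linarith
  refine opNorm_le_of_unit (by positivity) fun x hx => ?_
  obtain ⟨y, hy, hy1, hxy⟩ := exists_gridPoints_near hm hx.le
  have h1 : Z *ᵥ x = Z *ᵥ y + Z *ᵥ (x - y) := by rw [← Matrix.mulVec_add, add_sub_cancel]
  rw [h1]
  refine (eucNorm_add_le _ _).trans (add_le_add (h y hy hy1) ?_)
  exact (eucNorm_mulVec_le _ _).trans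
    (mul_le_mul_of_nonneg_left (hxy.trans hkm) (norm_nonneg _))

theorem gaussianRows_opNorm_tail {n k m : ℕ} (hm : 0 < m) (hkm : √k / m ≤ 1 / 4) :
    gaussianRows n k {Z | ¬ ‖(Matrix.of Z : Matrix (Fin n) (Fin k) ℝ)‖ ≤ 2 * √n} ≤
      ENNReal.ofReal ((2 * m + 1) ^ k * Real.exp (-n / 5)) := by
  have hsub : {Z | ¬ ‖(Matrix.of Z : Matrix (Fin n) (Fin k) ℝ)‖ ≤ 2 * √n} ⊆
      ⋃ y ∈ (gridPoints k m).filter fun y => ∑ j, y j ^ 2 ≤ 1,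
        {Z | 9 / 4 * n ≤ ∑ i, (∑ j, Z i j * y j) ^ 2} := by
    intro Z hZ
    by_contra hcon
    refine hZ (opNorm_le_of_gridPoints hm hkm fun y hy hy1 => ?_)
    simp only [Set.mem_iUnion, Finset.mem_filter, not_exists, Set.mem_ofPred_eq, not_le] at hcon
    have h1 := hcon y ⟨hy, by rw [← eucNorm_sq]; exact pow_le_one₀ (eucNorm_nonneg _) hy1⟩
    rw [← sq_le_sq₀ (eucNorm_nonneg _) (by positivity), eucNorm_sq, mul_pow,
      Real.sq_sqrt (by positivity)]
    norm_num
    exact h1.le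
  refine (measure_mono hsub).trans ((measure_biUnion_finset_le _ _).trans ?_)
  refine (Finset.sum_le_card_nsmul _ _ _ fun y hy =>
    gaussianRows_mulVec_tail (Finset.mem_filter.1 hy).2).trans ?_
  rw [nsmul_eq_mul, ENNReal.ofReal_mul (by positivity)]
  gcongr
  rw [← ENNReal.ofReal_natCast]
  refine ENNReal.ofReal_le_ofReal ?_
  exact_mod_cast (Finset.card_filter_le _ _).trans (card_gridPoints_le k m)

/-- Here y approximates x and w approximates UᵀZx / n, which lies in the unit ball because ‖Z‖ ≤
2√n. The scaling by n lets one grid serve both. -/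
theorem eucNorm_lower_of_gridPoints {n k : ℕ} (hn : 1000 ≤ n) (hkn : k ≤ n)
    {M Z U : Matrix (Fin n) (Fin k) ℝ} (hU : IsOrthonormalMatrix U) (hM : ‖M‖ ≤ 8 * n)
    (hZ : ‖Z‖ ≤ 2 * √n)
    (h : ∀ y ∈ gridPoints k (n ^ 2), ∀ w ∈ gridPoints k (n ^ 2), 1 / 4 ≤ ∑ j, y j ^ 2 →
      (n : ℝ) / 32 < ∑ i, ((M *ᵥ y - (n : ℝ) • U *ᵥ w) i + ∑ j, Z i j * y j) ^ 2)
    {x : Fin k → ℝ} (hx : eucNorm x = 1) :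
    √n / 8 ≤ eucNorm ((M + Z - U * Uᵀ * Z) *ᵥ x) := by
  have hn' : (1000 : ℝ) ≤ n := by exact_mod_cast hn
  have hn0 : (0 : ℝ) < n := by linarith
  set s := √(n : ℝ) with hs
  have hss : s * s = n := Real.mul_self_sqrt hn0.le
  have hs0 : 0 < s := Real.sqrt_pos.2 hn0
  have hs30 : 30 ≤ s := Real.le_sqrt_of_sq_le (by linarith)
  have hm : 0 < n ^ 2 := by positivity
  have hδ : √(k : ℝ) / ((n ^ 2 : ℕ) : ℝ) ≤ 1 / (n * s) := by
    calc √(k : ℝ) / ((n ^ 2 : ℕ) : ℝ) ≤ s / (n * (s * s)) := by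
          rw [hss]; push_cast; rw [sq]; gcongr
          exact Real.sqrt_le_sqrt (by exact_mod_cast hkn)
      _ = _ := by field_simp
  have hw1 : eucNorm ((1 / n : ℝ) • Uᵀ *ᵥ (Z *ᵥ x)) ≤ 1 := by
    rw [eucNorm_smul, abs_of_pos (by positivity), one_div, inv_mul_le_iff₀ hn0, mul_one]
    refine (hU.eucNorm_transpose_mulVec_le _).trans ((eucNorm_mulVec_le _ _).trans ?_)
    rw [hx, mul_one]
    nlinarith
  obtain ⟨y, hy, hy1, hxy⟩ := exists_gridPoints_near hm hx.le
  obtain ⟨w, hw, -, hzw⟩ := exists_gridPoints_near hm hw1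
  have hδ2 : 1 / (n * s) ≤ 1 / 2 := by gcongr; nlinarith
  have hylow : 1 / 2 ≤ eucNorm y := by
    have := eucNorm_add_le (x - y) y
    rw [sub_add_cancel, hx] at this
    linarith
  have hgrid := h y hy w hw (by rw [← eucNorm_sq]; nlinarith)
  have hv' : (fun i => (M *ᵥ y - (n : ℝ) • U *ᵥ w) i + ∑ j, Z i j * y j) =
      (M + Z - U * Uᵀ * Z) *ᵥ x - (M *ᵥ (x - y) + Z *ᵥ (x - y)
        - (n : ℝ) • U *ᵥ ((1 / n : ℝ) • Uᵀ *ᵥ (Z *ᵥ x) - w)) := by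
    have h0 : (fun i => (M *ᵥ y - (n : ℝ) • U *ᵥ w) i + ∑ j, Z i j * y j) =
        M *ᵥ y - (n : ℝ) • U *ᵥ w + Z *ᵥ y := rfl
    rw [h0, Matrix.mulVec_sub U, Matrix.mulVec_smul, smul_sub, smul_smul,
      mul_one_div_cancel hn0.ne', one_smul, Matrix.sub_mulVec, Matrix.add_mulVec,
      Matrix.mulVec_sub, Matrix.mulVec_sub, ← Matrix.mulVec_mulVec, ← Matrix.mulVec_mulVec]
    abel
  -- As (7/40)² < 1/32, this leaves √n/20 above the target √n/8 to absorb a discretization error of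
  -- at most 1/2.
  have hbig : 7 / 40 * s ≤ eucNorm (fun i => (M *ᵥ y - (n : ℝ) • U *ᵥ w) i + ∑ j, Z i j * y j) := by
    rw [← sq_le_sq₀ (by positivity) (eucNorm_nonneg _), eucNorm_sq]
    refine le_trans ?_ hgrid.le
    nlinarith
  rw [hv'] at hbig
  have herr : eucNorm (M *ᵥ (x - y) + Z *ᵥ (x - y)
        - (n : ℝ) • U *ᵥ ((1 / n : ℝ) • Uᵀ *ᵥ (Z *ᵥ x) - w)) ≤
      8 * n * (1 / (n * s)) + 2 * s * (1 / (n * s)) + n * (1 / (n * s)) := by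
    refine (eucNorm_sub_le _ _).trans (add_le_add ((eucNorm_add_le _ _).trans
      (add_le_add ?_ ?_)) ?_)
    · exact (eucNorm_mulVec_le _ _).trans
        (mul_le_mul hM (hxy.trans hδ) (eucNorm_nonneg _) (by positivity))
    · exact (eucNorm_mulVec_le _ _).trans
        (mul_le_mul hZ (hxy.trans hδ) (eucNorm_nonneg _) (by positivity))
    · rw [eucNorm_smul, abs_of_pos hn0, hU.eucNorm_mulVec]
      exact mul_le_mul_of_nonneg_left (hzw.trans hδ) hn0.le
  have herr2 : 8 * n * (1 / (n * s)) + 2 * s * (1 / (n * s)) + n * (1 / (n * s)) ≤ 1 / 2 := by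
    have : 8 * n * (1 / (n * s)) + 2 * s * (1 / (n * s)) + n * (1 / (n * s)) =
        9 / s + 2 / n := by field_simp; ring
    rw [this]
    have h1 : 9 / s ≤ 9 / 30 := by gcongr
    have h2 : 2 / (n : ℝ) ≤ 2 / 1000 := by gcongr
    linarith
  have := eucNorm_sub_le ((M + Z - U * Uᵀ * Z) *ᵥ x) (M *ᵥ (x - y) + Z *ᵥ (x - y)
        - (n : ℝ) • U *ᵥ ((1 / n : ℝ) • Uᵀ *ᵥ (Z *ᵥ x) - w))
  linarith

theorem gaussianRows_eucNorm_lower {n k : ℕ} (hn : 1000 ≤ n) (hkn : k ≤ n)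
    {M U : Matrix (Fin n) (Fin k) ℝ} (hU : IsOrthonormalMatrix U) (hM : ‖M‖ ≤ 8 * n) :
    gaussianRows n k {Z | ‖(Matrix.of Z : Matrix (Fin n) (Fin k) ℝ)‖ ≤ 2 * √n ∧
      ¬ ∀ x, eucNorm x = 1 →
        √n / 8 ≤ eucNorm ((M + Matrix.of Z - U * Uᵀ * Matrix.of Z) *ᵥ x)} ≤
      ENNReal.ofReal (((2 * (n : ℝ) ^ 2 + 1) ^ k) ^ 2 * Real.exp (-n / 5)) := by
  have hsub : {Z | ‖(Matrix.of Z : Matrix (Fin n) (Fin k) ℝ)‖ ≤ 2 * √n ∧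
      ¬ ∀ x, eucNorm x = 1 →
        √n / 8 ≤ eucNorm ((M + Matrix.of Z - U * Uᵀ * Matrix.of Z) *ᵥ x)} ⊆
      ⋃ p ∈ (gridPoints k (n ^ 2) ×ˢ gridPoints k (n ^ 2)).filter
          fun p => 1 / 4 ≤ ∑ j, p.1 j ^ 2,
        {Z | ∑ i, ((M *ᵥ p.1 - (n : ℝ) • U *ᵥ p.2) i + ∑ j, Z i j * p.1 j) ^ 2 ≤ n / 32} := by
    rintro Z ⟨hZ, hZ2⟩
    by_contra hcon
    refine hZ2 fun x hx => eucNorm_lower_of_gridPoints hn hkn hU hM hZ (fun y hy w hw hyl => ?_) hx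
    simp only [Set.mem_iUnion, Finset.mem_filter, not_exists, Set.mem_ofPred_eq, not_le] at hcon
    exact hcon (y, w) ⟨Finset.mem_product.2 ⟨hy, hw⟩, hyl⟩
  refine (measure_mono hsub).trans ((measure_biUnion_finset_le _ _).trans ?_)
  refine (Finset.sum_le_card_nsmul _ _ _ fun p hp =>
    gaussianRows_small_ball (Finset.mem_filter.1 hp).2 _).trans ?_
  rw [nsmul_eq_mul, ENNReal.ofReal_mul (by positivity)]
  gcongr
  rw [← ENNReal.ofReal_natCast]
  refine ENNReal.ofReal_le_ofReal ?_
  have h1 := card_gridPoints_le k (n ^ 2)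
  have h2 := (Finset.card_filter_le (gridPoints k (n ^ 2) ×ˢ gridPoints k (n ^ 2))
    fun p => 1 / 4 ≤ ∑ j, p.1 j ^ 2).trans_eq (Finset.card_product _ _)
  rw [← sq] at h2
  exact_mod_cast h2.trans (Nat.pow_le_pow_left h1 2)

/-! ### Coherence of the QR factor -/

section coherence

variable {n k : ℕ}

theorem IsOrthonormalMatrix.eucNorm_sub_mulVec_le {U : Matrix (Fin n) (Fin k) ℝ}
    (hU : IsOrthonormalMatrix U) (v : Fin n → ℝ) :
    eucNorm (v - U *ᵥ (Uᵀ *ᵥ v)) ≤ eucNorm v := by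
  rw [← sq_le_sq₀ (eucNorm_nonneg _) (eucNorm_nonneg _), ← dotProduct_self_eq,
    ← dotProduct_self_eq]
  have h1 : (U *ᵥ (Uᵀ *ᵥ v)) ⬝ᵥ (U *ᵥ (Uᵀ *ᵥ v)) = eucNorm (Uᵀ *ᵥ v) ^ 2 := by
    rw [dotProduct_self_eq, hU.eucNorm_mulVec]
  have h2 : v ⬝ᵥ (U *ᵥ (Uᵀ *ᵥ v)) = eucNorm (Uᵀ *ᵥ v) ^ 2 := by
    rw [← dotProduct_self_eq, Matrix.dotProduct_mulVec v, ← Matrix.mulVec_transpose]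
  rw [sub_dotProduct, dotProduct_sub, dotProduct_sub, h1, dotProduct_comm (U *ᵥ (Uᵀ *ᵥ v)) v, h2]
  nlinarith [sq_nonneg (eucNorm (Uᵀ *ᵥ v))]

theorem IsOrthonormalMatrix.opNorm_sub_mul_le {U : Matrix (Fin n) (Fin k) ℝ}
    (hU : IsOrthonormalMatrix U) (E : Matrix (Fin n) (Fin k) ℝ) : ‖E - U * Uᵀ * E‖ ≤ ‖E‖ := by
  refine opNorm_le_of_unit (norm_nonneg _) fun x hx => ?_
  rw [Matrix.sub_mulVec, ← Matrix.mulVec_mulVec, ← Matrix.mulVec_mulVec]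
  simpa [hx] using (hU.eucNorm_sub_mulVec_le _).trans (eucNorm_mulVec_le E x)

/-- Pair the row r with itself: ‖r‖² = U i ⬝ᵥ UᵀEr ≤ ‖U i‖ ‖E‖ ‖r‖, then cancel ‖r‖. -/
theorem IsOrthonormalMatrix.eucNorm_row_mul_le {U : Matrix (Fin n) (Fin k) ℝ}
    (hU : IsOrthonormalMatrix U) (E : Matrix (Fin n) (Fin k) ℝ) (i : Fin n) :
    eucNorm ((U * Uᵀ * E) i) ≤ eucNorm (U i) * ‖E‖ := by
  set r := (U * Uᵀ * E) i with hr
  have h1 : eucNorm r ^ 2 = U i ⬝ᵥ (Uᵀ *ᵥ (E *ᵥ r)) := by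
    rw [← dotProduct_self_eq, Matrix.mulVec_mulVec, Matrix.dotProduct_mulVec]
    congr 1
    rw [hr, Matrix.mul_assoc]
    rfl
  have h2 : eucNorm r ^ 2 ≤ eucNorm (U i) * (‖E‖ * eucNorm r) := by
    rw [h1]
    refine ((le_abs_self _).trans (abs_dotProduct_le _ _)).trans
      (mul_le_mul_of_nonneg_left ?_ (eucNorm_nonneg _))
    exact (hU.eucNorm_transpose_mulVec_le _).trans (eucNorm_mulVec_le _ _)
  rcases (eucNorm_nonneg r).eq_or_lt with h | h
  · rw [← h]; exact mul_nonneg (eucNorm_nonneg _) (norm_nonneg _)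
  · nlinarith

/-- The lower bound makes R invertible, so Rz = Q i has a solution with ‖z‖ ≤ ‖Q i‖ / γ. Coordinate
i of Wz is then ‖Q i‖²; splitting Wz along U and its complement and cancelling ‖Q i‖ gives the
claim. -/
theorem IsQRFactor.eucNorm_row_le {W Q U : Matrix (Fin n) (Fin k) ℝ} (hQ : IsQRFactor W Q)
    (hU : IsOrthonormalMatrix U) {γ : ℝ} (hγ : 0 < γ)
    (h : ∀ x, eucNorm x = 1 → γ ≤ eucNorm ((W - U * Uᵀ * W) *ᵥ x)) (i : Fin n) :
    eucNorm (Q i) ≤ eucNorm (U i) + eucNorm ((W - U * Uᵀ * W) i) / γ := by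
  obtain ⟨hQo, R, -, hW⟩ := hQ
  have hlow : ∀ x, γ * eucNorm x ≤ eucNorm ((W - U * Uᵀ * W) *ᵥ x) := by
    intro x
    rcases (eucNorm_nonneg x).eq_or_lt with h0 | h0
    · rw [← h0, mul_zero]; exact eucNorm_nonneg _
    · have h1 := h ((eucNorm x)⁻¹ • x) (by
        rw [eucNorm_smul, abs_of_pos (inv_pos.2 h0), inv_mul_cancel₀ h0.ne'])
      rw [Matrix.mulVec_smul, eucNorm_smul, abs_of_pos (inv_pos.2 h0), inv_mul_eq_div,
        le_div_iff₀ h0] at h1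
      exact h1
  have hsub : ∀ x, (W - U * Uᵀ * W) *ᵥ x = W *ᵥ x - U *ᵥ (Uᵀ *ᵥ (W *ᵥ x)) := by
    intro x
    rw [Matrix.sub_mulVec, ← Matrix.mulVec_mulVec, ← Matrix.mulVec_mulVec]
  have hWx : ∀ x, γ * eucNorm x ≤ eucNorm (W *ᵥ x) := fun x =>
    (hlow x).trans (by rw [hsub]; exact hU.eucNorm_sub_mulVec_le _)
  have hinj : Function.Injective R.mulVec := by
    rw [← Matrix.coe_mulVecLin, ← LinearMap.ker_eq_bot, LinearMap.ker_eq_bot']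
    intro x hx
    rw [Matrix.mulVecLin_apply] at hx
    have h1 := hWx x
    rw [hW, ← Matrix.mulVec_mulVec, hx, Matrix.mulVec_zero] at h1
    have h2 : eucNorm (0 : Fin n → ℝ) = 0 := by simp [eucNorm]
    have h3 : eucNorm x = 0 := by nlinarith [eucNorm_nonneg x]
    simpa [eucNorm] using h3
  obtain ⟨z, hz⟩ := Matrix.mulVec_surjective_iff_isUnit.2
    (Matrix.mulVec_injective_iff_isUnit.1 hinj) (Q i)
  have hWz : W *ᵥ z = Q *ᵥ Q i := by rw [hW, ← Matrix.mulVec_mulVec]; exact congrArg _ hz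
  have hWzn : eucNorm (W *ᵥ z) = eucNorm (Q i) := by rw [hWz, hQo.eucNorm_mulVec]
  have hzn : eucNorm z ≤ eucNorm (Q i) / γ := by
    rw [le_div_iff₀ hγ, mul_comm, ← hWzn]; exact hWx z
  have hdec : eucNorm (Q i) ^ 2 =
      U i ⬝ᵥ (Uᵀ *ᵥ (W *ᵥ z)) + (W - U * Uᵀ * W) i ⬝ᵥ z := by
    have h1 : (W *ᵥ z) i = eucNorm (Q i) ^ 2 := by rw [hWz, ← dotProduct_self_eq]; rfl
    have h2 := congrFun (hsub z) i
    rw [Pi.sub_apply, h1] at h2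
    change (W - U * Uᵀ * W) i ⬝ᵥ z = _ - U i ⬝ᵥ (Uᵀ *ᵥ (W *ᵥ z)) at h2
    linarith
  have hb1 : U i ⬝ᵥ (Uᵀ *ᵥ (W *ᵥ z)) ≤ eucNorm (U i) * eucNorm (Q i) := by
    refine ((le_abs_self _).trans (abs_dotProduct_le _ _)).trans
      (mul_le_mul_of_nonneg_left ?_ (eucNorm_nonneg _))
    rw [← hWzn]
    exact hU.eucNorm_transpose_mulVec_le _
  have hb2 : (W - U * Uᵀ * W) i ⬝ᵥ z ≤ eucNorm ((W - U * Uᵀ * W) i) * (eucNorm (Q i) / γ) :=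
    ((le_abs_self _).trans (abs_dotProduct_le _ _)).trans
      (mul_le_mul_of_nonneg_left hzn (eucNorm_nonneg _))
  rcases (eucNorm_nonneg (Q i)).eq_or_lt with h0 | h0
  · rw [← h0]; exact add_nonneg (eucNorm_nonneg _) (div_nonneg (eucNorm_nonneg _) hγ.le)
  · have h3 : eucNorm (Q i) * eucNorm (Q i) ≤
        (eucNorm (U i) + eucNorm ((W - U * Uᵀ * W) i) / γ) * eucNorm (Q i) := by
      calc _ = eucNorm (Q i) ^ 2 := (sq _).symm
        _ ≤ eucNorm (U i) * eucNorm (Q i) +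
            eucNorm ((W - U * Uᵀ * W) i) * (eucNorm (Q i) / γ) := hdec.le.trans (add_le_add hb1 hb2)
        _ = _ := by ring
    exact le_of_mul_le_mul_right h3 h0

theorem mul_eucNorm_row_sq_le_coherence (U : Matrix (Fin n) (Fin k) ℝ) (i : Fin n) :
    (n : ℝ) / k * eucNorm (U i) ^ 2 ≤ coherence U := by
  rw [eucNorm_sq]
  exact le_ciSup (f := fun i : Fin n => ((n : ℝ) / k) * ∑ j, U i j ^ 2)
    (Set.finite_range _).bddAbove i

theorem mul_eucNorm_row_sq_le_rho (G : Matrix (Fin n) (Fin k) ℝ) (i : Fin n) :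
    (n : ℝ) / k * eucNorm (G i) ^ 2 ≤ rho G := by
  rw [eucNorm_sq]
  exact mul_le_mul_of_nonneg_left (le_ciSup (f := fun i : Fin n => ∑ j, G i j ^ 2)
    (Set.finite_range _).bddAbove i) (by positivity)

theorem coherence_nonneg (U : Matrix (Fin n) (Fin k) ℝ) : 0 ≤ coherence U :=
  Real.iSup_nonneg fun _ => by positivity

theorem rho_nonneg (G : Matrix (Fin n) (Fin k) ℝ) : 0 ≤ rho G :=
  mul_nonneg (by positivity) (Real.iSup_nonneg fun _ => by positivity)

/-- Cauchy-Schwarz on five terms gives a factor 5. The resulting coefficients are at most 5·(1 +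
4096), 5·1024 and 5·256·22 = 28160, all below 30000. -/
theorem row_bound_arith {κ a p g h q σ τ ν cU ρN ρG ℓ μ : ℝ} (hκ : 0 ≤ κ) (hτ : 0 < τ)
    (hτ1 : τ < 1) (hν : 0 < ν) (hσ : σ ≤ τ * ν / 2) (hσ0 : 0 < σ) (hℓ : 1 ≤ ℓ) (hcU : 0 ≤ cU)
    (hρN : 0 ≤ ρN) (hρG : 0 ≤ ρG) (hq0 : 0 ≤ q)
    (ha : κ * a ^ 2 ≤ cU) (hp : κ * p ^ 2 ≤ ρN) (hg : κ * g ^ 2 ≤ ρG)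
    (hh : κ * h ^ 2 ≤ 22 * σ ^ 2 * ℓ)
    (hq : q ≤ a + (p + g + h + a * (2 * ν)) * (32 / (τ * ν)))
    (hμ : 30000 / τ ^ 2 * (cU + (ρG + ρN) / ν ^ 2 + ℓ) ≤ μ) : κ * q ^ 2 ≤ μ := by
  set D := 32 / (τ * ν) with hD
  have hD2 : D ^ 2 = 1024 / (τ ^ 2 * ν ^ 2) := by rw [hD, div_pow, mul_pow]; norm_num
  have h1 : q ^ 2 ≤ 5 * (a ^ 2 + D ^ 2 * p ^ 2 + D ^ 2 * g ^ 2 + D ^ 2 * h ^ 2 +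
      4 * (D ^ 2 * ν ^ 2) * a ^ 2) := by
    refine (pow_le_pow_left₀ hq0 hq 2).trans ?_
    have := sq_nonneg (a - D * p)
    have := sq_nonneg (a - D * g)
    have := sq_nonneg (a - D * h)
    have := sq_nonneg (a - 2 * D * ν * a)
    have := sq_nonneg (D * p - D * g)
    have := sq_nonneg (D * p - D * h)
    have := sq_nonneg (D * p - 2 * D * ν * a)
    have := sq_nonneg (D * g - D * h)
    have := sq_nonneg (D * g - 2 * D * ν * a)
    have := sq_nonneg (D * h - 2 * D * ν * a)
    linarith
  have hDν : D ^ 2 * ν ^ 2 = 1024 / τ ^ 2 := by rw [hD2]; field_simp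
  have hDσ : D ^ 2 * σ ^ 2 ≤ 256 := by
    have : σ ^ 2 ≤ (τ * ν / 2) ^ 2 := pow_le_pow_left₀ hσ0.le hσ 2
    calc D ^ 2 * σ ^ 2 ≤ D ^ 2 * (τ * ν / 2) ^ 2 := by gcongr
      _ = 256 := by rw [hD2]; field_simp; norm_num
  have hτ2 : 1 ≤ 1 / τ ^ 2 := by
    rw [le_div_iff₀ (by positivity), one_mul]; exact pow_le_one₀ hτ.le hτ1.le
  set T := 1 / τ ^ 2 with hT
  have hT2 : D ^ 2 * ν ^ 2 = 1024 * T := by rw [hDν, hT]; ring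
  have h2 : κ * q ^ 2 ≤ 5 * (cU + D ^ 2 * ρN + D ^ 2 * ρG + 256 * 22 * ℓ + 4 * (1024 * T) * cU) := by
    calc κ * q ^ 2 ≤ κ * (5 * (a ^ 2 + D ^ 2 * p ^ 2 + D ^ 2 * g ^ 2 + D ^ 2 * h ^ 2 +
          4 * (D ^ 2 * ν ^ 2) * a ^ 2)) := by gcongr
      _ = 5 * (κ * a ^ 2 + D ^ 2 * (κ * p ^ 2) + D ^ 2 * (κ * g ^ 2) + D ^ 2 * (κ * h ^ 2) +
          4 * (D ^ 2 * ν ^ 2) * (κ * a ^ 2)) := by ring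
      _ ≤ 5 * (cU + D ^ 2 * ρN + D ^ 2 * ρG + D ^ 2 * (22 * σ ^ 2 * ℓ) +
          4 * (D ^ 2 * ν ^ 2) * cU) := by gcongr
      _ = 5 * (cU + D ^ 2 * ρN + D ^ 2 * ρG + (D ^ 2 * σ ^ 2) * 22 * ℓ +
          4 * (1024 * T) * cU) := by rw [hT2]; ring
      _ ≤ _ := by gcongr
  have hDρ : D ^ 2 * ρN + D ^ 2 * ρG = 1024 * (T * ((ρG + ρN) / ν ^ 2)) := by
    rw [hD2, hT]; field_simp; ring
  have h3 : 30000 / τ ^ 2 * (cU + (ρG + ρN) / ν ^ 2 + ℓ) =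
      30000 * (T * cU) + 30000 * (T * ((ρG + ρN) / ν ^ 2)) + 30000 * (T * ℓ) := by
    rw [hT]; ring
  rw [h3] at hμ
  have h4 : cU ≤ T * cU := le_mul_of_one_le_left hcU hτ2
  have h5 : ℓ ≤ T * ℓ := le_mul_of_one_le_left (by linarith) hτ2
  have h6 : 0 ≤ T * ((ρG + ρN) / ν ^ 2) := by positivity
  linarith

theorem coherence_qr_le {Y N' U G Z Q : Matrix (Fin n) (Fin k) ℝ} {σ τ ν μ : ℝ}
    (hn : 1000 ≤ n) (hk : 0 < k) (hU : IsOrthonormalMatrix U) (hτ : 0 < τ) (hτ1 : τ < 1)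
    (hν : 0 < ν) (hG : ‖G‖ ≤ ν) (hY : Y - U * Uᵀ * Y = N' + (G - U * Uᵀ * G))
    (hσ1 : τ * ν / 4 < σ) (hσ2 : σ ≤ τ * ν / 2)
    (hμ : 30000 / τ ^ 2 * (coherence U + (rho G + rho N') / ν ^ 2 + Real.log n) ≤ μ)
    (hZ : ‖Z‖ ≤ 2 * √n)
    (hlow : ∀ x, eucNorm x = 1 →
      √n / 8 ≤ eucNorm (((√n / σ) • (Y - U * Uᵀ * Y) + Z - U * Uᵀ * Z) *ᵥ x))
    (hrow : ∀ i, ∑ j, Z i j ^ 2 ≤ 2 * k + 20 * Real.log n)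
    (hQ : IsQRFactor (Y + (σ / √n) • Z) Q) : coherence Q ≤ μ := by
  have hn' : (1000 : ℝ) ≤ n := by exact_mod_cast hn
  have hn0 : (0 : ℝ) < n := by linarith
  have hk' : (1 : ℝ) ≤ k := by exact_mod_cast hk
  have hs0 : 0 < √(n : ℝ) := Real.sqrt_pos.2 hn0
  have hσ0 : 0 < σ := lt_of_le_of_lt (by positivity) hσ1
  have hℓ : 1 ≤ Real.log n := by
    rw [Real.le_log_iff_exp_le hn0]
    linarith [Real.exp_one_lt_d9]
  have : Nonempty (Fin n) := ⟨⟨0, by omega⟩⟩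
  set H := (σ / √n) • Z with hH
  have hHn : ‖H‖ ≤ ν := by
    rw [hH, norm_smul, Real.norm_of_nonneg (by positivity)]
    calc σ / √n * ‖Z‖ ≤ σ / √n * (2 * √n) := by gcongr
      _ = 2 * σ := by field_simp
      _ ≤ ν := by nlinarith
  have hWdec : Y + H - U * Uᵀ * (Y + H) =
      (σ / √n) • ((√n / σ) • (Y - U * Uᵀ * Y) + Z - U * Uᵀ * Z) := by
    rw [smul_sub, smul_add, smul_smul, ← Matrix.mul_smul, ← hH,
      show σ / √n * (√n / σ) = 1 by field_simp, one_smul, Matrix.mul_add]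
    abel
  have hW : ∀ x, eucNorm x = 1 →
      σ / 8 ≤ eucNorm ((Y + H - U * Uᵀ * (Y + H)) *ᵥ x) := by
    intro x hx
    rw [hWdec, Matrix.smul_mulVec, eucNorm_smul, abs_of_pos (by positivity)]
    calc σ / 8 = σ / √n * (√n / 8) := by field_simp
      _ ≤ _ := mul_le_mul_of_nonneg_left (hlow x hx) (by positivity)
  refine ciSup_le fun i => ?_
  have hrowQ := hQ.eucNorm_row_le hU (by positivity) hW i
  have hrowW : eucNorm ((Y + H - U * Uᵀ * (Y + H)) i) ≤
      eucNorm (N' i) + eucNorm (G i) + eucNorm (H i) + eucNorm (U i) * (2 * ν) := by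
    have h1 : (Y + H - U * Uᵀ * (Y + H)) i = N' i + G i + H i - (U * Uᵀ * (G + H)) i := by
      have : Y + H - U * Uᵀ * (Y + H) = N' + G + H - U * Uᵀ * (G + H) := by
        rw [Matrix.mul_add, Matrix.mul_add,
          show Y + H - (U * Uᵀ * Y + U * Uᵀ * H) = (Y - U * Uᵀ * Y) + (H - U * Uᵀ * H) by abel, hY]
        abel
      rw [this]; rfl
    rw [h1]
    refine (eucNorm_sub_le _ _).trans (add_le_add ((eucNorm_add_le _ _).trans
      (add_le_add (eucNorm_add_le _ _) le_rfl)) ?_)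
    refine (hU.eucNorm_row_mul_le _ i).trans (mul_le_mul_of_nonneg_left ?_ (eucNorm_nonneg _))
    linarith [norm_add_le G H]
  have hrowH : (n : ℝ) / k * eucNorm (H i) ^ 2 ≤ 22 * σ ^ 2 * Real.log n := by
    have h1 : eucNorm (H i) = σ / √n * eucNorm (Z i) := by
      rw [← abs_of_pos (show 0 < σ / √n by positivity), ← eucNorm_smul]; rfl
    rw [h1, mul_pow, div_pow, Real.sq_sqrt hn0.le, eucNorm_sq]
    calc (n : ℝ) / k * (σ ^ 2 / n * ∑ j, Z i j ^ 2)
        ≤ (n : ℝ) / k * (σ ^ 2 / n * (2 * k + 20 * Real.log n)) := by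
          gcongr; exact hrow i
      _ = σ ^ 2 * (2 + 20 * Real.log n / k) := by field_simp
      _ ≤ σ ^ 2 * (2 * Real.log n + 20 * Real.log n) := by
          gcongr
          · linarith
          · exact div_le_self (by linarith) hk'
      _ = _ := by ring
  rw [← eucNorm_sq]
  refine row_bound_arith (by positivity) hτ hτ1 hν hσ2 hσ0 hℓ (coherence_nonneg U)
    (rho_nonneg N') (rho_nonneg G) (eucNorm_nonneg _) (mul_eucNorm_row_sq_le_coherence U i)
    (mul_eucNorm_row_sq_le_rho N' i) (mul_eucNorm_row_sq_le_rho G i) hrowH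
    (hrowQ.trans ?_) hμ
  gcongr
  rw [div_eq_mul_inv]
  refine mul_le_mul hrowW ?_ (by positivity) ?_
  · rw [inv_div, div_le_div_iff₀ hσ0 (by positivity)]
    linarith
  · have := eucNorm_nonneg (N' i)
    have := eucNorm_nonneg (G i)
    have := eucNorm_nonneg (H i)
    have := eucNorm_nonneg (U i)
    positivity

end coherence

/-! ### Termination of the loop -/

section algorithm

variable {n k : ℕ} (qr : Matrix (Fin n) (Fin k) ℝ → Matrix (Fin n) (Fin k) ℝ)
  (Y : Matrix (Fin n) (Fin k) ℝ) (ε : ℝ) (Z : ℕ → Matrix (Fin n) (Fin k) ℝ)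

theorem stateAfter_σ (t : ℕ) : (stateAfter qr Y ε Z t).σ = 2 ^ t * (ε * ‖Y‖ / n) := by
  induction t with
  | zero => simp [stateAfter, initState]
  | succ t ih => simp only [stateAfter, loopBody, ih]; ring

theorem exists_smoothQROutputs {μ B : ℝ} {s : ℕ} (hn : 0 < n) (hε : 0 < ε)
    (hs : 2 ^ s * (ε * ‖Y‖ / n) ≤ B / 2) (hB : B ≤ ‖Y‖) (hB0 : 0 < B)
    (hZ : ∀ t ≤ s, ‖Z t‖ ≤ 2 * √n)
    (hcoh : coherence (qr (Y + ((2 ^ s * (ε * ‖Y‖ / n)) / √n) • Z s)) ≤ μ) :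
    ∃ (T : ℕ) (X' H : Matrix (Fin n) (Fin k) ℝ), SmoothQROutputs qr Y ε μ Z T X' H ∧
      T ≤ s + 1 ∧ coherence X' ≤ μ ∧ ‖H‖ ≤ B := by
  classical
  have hs0 : 0 < √(n : ℝ) := Real.sqrt_pos.2 (by exact_mod_cast hn)
  have hex : ¬ Guard Y μ (stateAfter qr Y ε Z (s + 1)) := by
    rintro ⟨h, -⟩
    simp only [stateAfter, loopBody, stateAfter_σ] at h
    exact absurd hcoh (not_le.2 h)
  have hexi : ∃ T, ¬ Guard Y μ (stateAfter qr Y ε Z T) := ⟨_, hex⟩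
  set T := Nat.find hexi with hT
  have hTs : T ≤ s + 1 := Nat.find_min' hexi hex
  have hmono : ∀ t ≤ s, 2 ^ t * (ε * ‖Y‖ / n) ≤ B / 2 := by
    intro t ht
    refine le_trans ?_ hs
    have : (2 : ℝ) ^ t ≤ 2 ^ s := pow_le_pow_right₀ (by norm_num) ht
    gcongr
  -- The level at the first exit is at most B ≤ ‖Y‖, so the guard can only have failed through its
  -- coherence condition.
  have hσT : (stateAfter qr Y ε Z T).σ ≤ ‖Y‖ := by
    rw [stateAfter_σ]
    calc 2 ^ T * (ε * ‖Y‖ / n) ≤ 2 ^ (s + 1) * (ε * ‖Y‖ / n) := by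
          have : (2 : ℝ) ^ T ≤ 2 ^ (s + 1) := pow_le_pow_right₀ (by norm_num) hTs
          gcongr
      _ = 2 * (2 ^ s * (ε * ‖Y‖ / n)) := by ring
      _ ≤ _ := by linarith
  have hspec : ¬ Guard Y μ (stateAfter qr Y ε Z T) := Nat.find_spec hexi
  refine ⟨T, _, _, ⟨fun t ht => not_not.1 (Nat.find_min hexi ht), hspec, rfl, rfl⟩, hTs, ?_, ?_⟩
  · by_contra hc
    exact hspec ⟨not_le.1 hc, hσT⟩
  · rcases hT0 : T with _ | t
    · simpa [stateAfter, initState] using hB0.le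
    · have hts : t ≤ s := by omega
      simp only [stateAfter, loopBody, stateAfter_σ]
      rw [norm_smul, Real.norm_of_nonneg (by positivity)]
      calc 2 ^ t * (ε * ‖Y‖ / n) / √n * ‖Z t‖
          ≤ 2 ^ t * (ε * ‖Y‖ / n) / √n * (2 * √n) := by gcongr; exact hZ t hts
        _ = 2 * (2 ^ t * (ε * ‖Y‖ / n)) := by field_simp
        _ ≤ B := by linarith [hmono t hts]

end algorithm

/-! ### Failure probability and assembly -/

/-- An inequality suffices for union bounds and holds for every set S, so no measurability of the
failure events is required. -/
theorem measure_gaussianSamples_le {Ω : Type*} [MeasurableSpace Ω] {P : Measure Ω}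
    [IsProbabilityMeasure P] {n k : ℕ} {Z : ℕ → Ω → Matrix (Fin n) (Fin k) ℝ}
    (hZ : IsGaussianSamples P Z) (t : ℕ) (S : Set (Fin n → Fin k → ℝ)) :
    P {ω | (fun i j => Z t ω i j) ∈ S} ≤ gaussianRows n k S := by
  have h := hasLaw_gaussianRows hZ t
  rw [← h.map_eq]
  exact Measure.le_map_apply h.aemeasurable S

theorem failure_bound_arith {n k s : ℕ} (hn : 1000 ≤ n)
    (hk : (k : ℝ) * Real.log n ≤ 1 / 100 * n) (hs : (s + 1 : ℝ) ≤ 2 * n) :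
    (s + 1) * ((2 * (n : ℝ) ^ 2 + 1) ^ k * Real.exp (-n / 5)) +
      ((2 * (n : ℝ) ^ 2 + 1) ^ k) ^ 2 * Real.exp (-n / 5) + n * ((n : ℝ) ^ 5)⁻¹ ≤
      10 ^ 12 / (n : ℝ) ^ 4 := by
  have hn' : (1000 : ℝ) ≤ n := by exact_mod_cast hn
  have hn0 : (0 : ℝ) < n := by linarith
  have hN : (2 * (n : ℝ) ^ 2 + 1) ^ k ≤ Real.exp (3 / 100 * n) := by
    calc (2 * (n : ℝ) ^ 2 + 1) ^ k ≤ ((n : ℝ) ^ 3) ^ k := by gcongr; nlinarith [sq_nonneg (n : ℝ)]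
      _ = Real.exp (3 * (k * Real.log n)) := by
          rw [← pow_mul, ← Real.exp_log (pow_pos hn0 (3 * k)), Real.log_pow]
          push_cast; ring_nf
      _ ≤ _ := Real.exp_le_exp.2 (by linarith)
  have hN1 : 1 ≤ (2 * (n : ℝ) ^ 2 + 1) ^ k := one_le_pow₀ (by nlinarith [sq_nonneg (n : ℝ)])
  set E := Real.exp (-(n / 10)) with hE
  have h2 : ((2 * (n : ℝ) ^ 2 + 1) ^ k) ^ 2 * Real.exp (-n / 5) ≤ E := by
    calc _ ≤ Real.exp (3 / 100 * n) ^ 2 * Real.exp (-n / 5) := by gcongr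
      _ = Real.exp (-(7 / 50 * n)) := by rw [← Real.exp_nat_mul, ← Real.exp_add]; ring_nf
      _ ≤ E := Real.exp_le_exp.2 (by linarith)
  have h1 : (2 * (n : ℝ) ^ 2 + 1) ^ k * Real.exp (-n / 5) ≤ E := by
    refine le_trans ?_ h2
    gcongr
    nlinarith
  -- Fifth Taylor term of exp(n/10), with 5!·10⁵ = 12000000; the fifth power pays for the factor n
  -- from the number of steps.
  have hE5 : E ≤ 12000000 / (n : ℝ) ^ 5 := by
    have := Real.pow_div_factorial_le_exp (x := n / 10) (by positivity) 5
    rw [hE, Real.exp_neg, inv_le_comm₀ (Real.exp_pos _) (by positivity)]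
    refine le_trans (le_of_eq ?_) this
    simp [Nat.factorial]
    field_simp
    norm_num
  calc _ ≤ 2 * n * E + E + n * ((n : ℝ) ^ 5)⁻¹ := by gcongr
    _ ≤ 3 * n * E + n * ((n : ℝ) ^ 5)⁻¹ := by
        have : 0 < E := Real.exp_pos _
        nlinarith
    _ ≤ 3 * n * (12000000 / (n : ℝ) ^ 5) + n * ((n : ℝ) ^ 5)⁻¹ := by gcongr
    _ = 36000001 / (n : ℝ) ^ 4 := by field_simp; norm_num
    _ ≤ _ := by gcongr; norm_num

end SmoothOrtho

end

open SmoothOrtho in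
theorem mainTheorem9 :
    -- absolute constants: `C` in the lower bound on `μ`, `c` in `k = o(n / log n)`,
    -- `L` in `O(log (n / ε))`, `K` in `O(n⁻⁴)`
    ∃ C c L K : ℝ, 0 < C ∧ 0 < c ∧ 0 < L ∧ 0 < K ∧
      ∀ (n k : ℕ) (τ : ℝ) (A : Matrix (Fin n) (Fin n) ℝ)
        (U : Matrix (Fin n) (Fin k) ℝ) (eig : Fin k → ℝ),
        (k : ℝ) * Real.log n ≤ c * n →
        0 < τ → τ < 1 →
        A.IsSymm → IsOrthonormalMatrix U → A * U = U * Matrix.diagonal eig →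
        coherence U * k ≤ n →
        ∀ (N : Matrix (Fin n) (Fin n) ℝ), N = (1 - U * Uᵀ) * A →
        ∀ (G X : Matrix (Fin n) (Fin k) ℝ) (ν : ℝ),
        IsOrthonormalMatrix X → 0 < ν → max ‖G‖ ‖N * X‖ ≤ ν →
        ∀ (ε μ : ℝ),
        C / τ ^ 2 * (coherence U + (rho G + rho (N * X)) / ν ^ 2 + Real.log n) ≤ μ →
        μ ≤ n →
        0 < ε → Real.log (n / ε) ≤ n →
        -- the noise levels searched by the algorithm cover the scale `τ ν`
        ε * ‖A * X + G‖ / n ≤ τ * ν / 2 → τ * ν ≤ ‖A * X + G‖ →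
        ∀ (qr : Matrix (Fin n) (Fin k) ℝ → Matrix (Fin n) (Fin k) ℝ), IsQRProcedure qr →
        ∀ (Ω : Type) [MeasurableSpace Ω] (P : Measure Ω) [IsProbabilityMeasure P]
          (Z : ℕ → Ω → Matrix (Fin n) (Fin k) ℝ), IsGaussianSamples P Z →
        P {ω | ¬ ∃ (T : ℕ) (X' H : Matrix (Fin n) (Fin k) ℝ),
            SmoothQROutputs qr (A * X + G) ε μ (fun t => Z t ω) T X' H ∧
            (T : ℝ) ≤ L * Real.log (n / ε) ∧ coherence X' ≤ μ ∧ ‖H‖ ≤ τ * ν}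
          ≤ ENNReal.ofReal (K / (n : ℝ) ^ 4) := by
  refine ⟨30000, 1 / 100, 2, 10 ^ 12, by norm_num, by norm_num, by norm_num, by norm_num, ?_⟩
  intro n k τ A U eig hkn hτ hτ1 _ hU _ _ N hN G X ν _ hν hGN ε μ hμ hμn hε hεn hlo hhi qr hqr Ω _
    P _ Z hZ
  set Y := A * X + G with hYdef
  have hYpos : 0 < ‖Y‖ := lt_of_lt_of_le (by positivity) hhi
  have hn0 : 0 < n := by
    rcases Nat.eq_zero_or_pos n with rfl | h
    · exact absurd hYpos (by rw [Subsingleton.elim Y 0, norm_zero]; exact lt_irrefl _)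
    · exact h
  have hk0 : 0 < k := by
    rcases Nat.eq_zero_or_pos k with rfl | h
    · exact absurd hYpos (by rw [Subsingleton.elim Y 0, norm_zero]; exact lt_irrefl _)
    · exact h
  have hn0' : (0 : ℝ) < n := by exact_mod_cast hn0
  -- For n < 1000 the claimed bound is at least 1, since K = 1000⁴.
  rcases lt_or_ge n 1000 with hsmall | hn
  · refine prob_le_one.trans ?_
    rw [← ENNReal.ofReal_one]
    refine ENNReal.ofReal_le_ofReal ?_
    rw [le_div_iff₀ (by positivity), one_mul]
    calc (n : ℝ) ^ 4 ≤ 1000 ^ 4 := by gcongr; exact_mod_cast hsmall.le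
      _ = _ := by norm_num
  have hn' : (1000 : ℝ) ≤ n := by exact_mod_cast hn
  have hℓ : 1 ≤ Real.log n := by
    rw [Real.le_log_iff_exp_le hn0']
    linarith [Real.exp_one_lt_d9]
  have hkn' : k ≤ n := by
    have h1 : (k : ℝ) * 1 ≤ k * Real.log n := by gcongr
    have h2 : (k : ℝ) ≤ n := by linarith
    exact_mod_cast h2
  -- the step whose noise level is just below `τ ν / 2`
  set σ₀ := ε * ‖Y‖ / n with hσ₀
  have hσ₀pos : 0 < σ₀ := by positivity
  obtain ⟨s, hs1, hs2⟩ := exists_nat_pow_near (x := τ * ν / 2 / σ₀) (y := (2 : ℝ))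
    (by rwa [le_div_iff₀ hσ₀pos, one_mul]) (by norm_num)
  rw [le_div_iff₀ hσ₀pos] at hs1
  rw [div_lt_iff₀ hσ₀pos, pow_succ] at hs2
  set σ := 2 ^ s * σ₀ with hσ
  have hσpos : 0 < σ := by positivity
  -- From 2σ ≤ τν ≤ ‖Y‖ one gets 2^(s+1) ≤ n/ε; the constant L = 2 comes from log 2 > 1/2.
  have hsL : (s + 1 : ℝ) ≤ 2 * Real.log (n / ε) := by
    have h1 : (2 : ℝ) ^ (s + 1) ≤ n / ε := by
      rw [le_div_iff₀ hε]
      have h3 : 2 ^ s * (ε * ‖Y‖ / n) ≤ ‖Y‖ / 2 := hs1.trans (by linarith)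
      rw [← mul_div_assoc, div_le_div_iff₀ hn0' (by norm_num)] at h3
      have h4 : 2 ^ (s + 1) * ε * ‖Y‖ ≤ n * ‖Y‖ := by rw [pow_succ]; linarith
      exact le_of_mul_le_mul_right h4 hYpos
    have h2 := Real.log_le_log (by positivity) h1
    rw [Real.log_pow] at h2
    push_cast at h2
    have h3 := Real.log_two_gt_d9
    nlinarith
  have hG : ‖G‖ ≤ ν := (le_max_left _ _).trans hGN
  have hNX : ‖N * X‖ ≤ ν := (le_max_right _ _).trans hGN
  have hYdec : Y - U * Uᵀ * Y = N * X + (G - U * Uᵀ * G) := by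
    rw [hN, hYdef]
    simp only [Matrix.mul_add, Matrix.sub_mul, Matrix.one_mul, Matrix.mul_assoc]
    abel
  -- The cap μ ≤ n keeps τ from being too small. This gives ‖M‖ ≤ 8n, which a grid of spacing n⁻²
  -- can resolve.
  have hτn : 1 / τ ≤ √n := by
    refine Real.le_sqrt_of_sq_le ?_
    have h1 : 1 ≤ coherence U + (rho G + rho (N * X)) / ν ^ 2 + Real.log n := by
      have := coherence_nonneg U
      have := rho_nonneg G
      have := rho_nonneg (N * X)
      have : 0 ≤ (rho G + rho (N * X)) / ν ^ 2 := by positivity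
      linarith
    calc (1 / τ) ^ 2 ≤ 30000 / τ ^ 2 * 1 := by
          rw [one_div, inv_pow, mul_one, ← one_div]; gcongr; norm_num
      _ ≤ 30000 / τ ^ 2 * (coherence U + (rho G + rho (N * X)) / ν ^ 2 + Real.log n) := by gcongr
      _ ≤ n := hμ.trans hμn
  set M := (√n / σ) • (Y - U * Uᵀ * Y) with hMdef
  have hM : ‖M‖ ≤ 8 * n := by
    have h1 : ‖Y - U * Uᵀ * Y‖ ≤ 2 * ν := by
      rw [hYdec]
      have := norm_add_le (N * X) (G - U * Uᵀ * G)
      have := hU.opNorm_sub_mul_le G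
      linarith
    have hs0 : 0 < √(n : ℝ) := Real.sqrt_pos.2 hn0'
    rw [hMdef, norm_smul, Real.norm_of_nonneg (by positivity)]
    calc √n / σ * ‖Y - U * Uᵀ * Y‖ ≤ √n / (τ * ν / 4) * (2 * ν) := by gcongr; linarith
      _ = 8 * √n * (1 / τ) := by field_simp; norm_num
      _ ≤ 8 * √n * √n := by gcongr
      _ = 8 * n := by rw [mul_assoc, Real.mul_self_sqrt hn0'.le]
  have hgrid : √(k : ℝ) / ((n ^ 2 : ℕ) : ℝ) ≤ 1 / 4 := by
    have h1 : √(k : ℝ) ≤ n := by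
      refine Real.sqrt_le_iff.2 ⟨hn0'.le, ?_⟩
      have : (k : ℝ) ≤ n := by exact_mod_cast hkn'
      nlinarith
    push_cast
    rw [div_le_div_iff₀ (by positivity) (by norm_num)]
    nlinarith
  have hsub : {ω | ¬ ∃ (T : ℕ) (X' H : Matrix (Fin n) (Fin k) ℝ),
        SmoothQROutputs qr Y ε μ (fun t => Z t ω) T X' H ∧
        (T : ℝ) ≤ 2 * Real.log (n / ε) ∧ coherence X' ≤ μ ∧ ‖H‖ ≤ τ * ν} ⊆
      ((⋃ t ∈ Finset.range (s + 1), {ω | (fun i j => Z t ω i j) ∈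
        {W : Fin n → Fin k → ℝ | ¬ ‖(Matrix.of W : Matrix (Fin n) (Fin k) ℝ)‖ ≤ 2 * √n}}) ∪
      {ω | (fun i j => Z s ω i j) ∈ {W : Fin n → Fin k → ℝ |
        ‖(Matrix.of W : Matrix (Fin n) (Fin k) ℝ)‖ ≤ 2 * √n ∧ ¬ ∀ x, eucNorm x = 1 →
          √n / 8 ≤ eucNorm ((M + Matrix.of W - U * Uᵀ * Matrix.of W) *ᵥ x)}}) ∪
      ⋃ i ∈ (Finset.univ : Finset (Fin n)), {ω | (fun i j => Z s ω i j) ∈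
        {W : Fin n → Fin k → ℝ | 2 * k + 20 * Real.log n ≤ ∑ j, W i j ^ 2}} := by
    intro ω hω
    by_contra hcon
    apply hω
    simp only [Set.mem_union, Set.mem_iUnion, not_or, not_exists, Set.mem_ofPred_eq, not_and,
      not_not, not_le, Finset.mem_range, Finset.mem_univ, forall_true_left] at hcon
    obtain ⟨⟨h1, h2⟩, h3⟩ := hcon
    have h1' : ∀ t ≤ s, ‖Z t ω‖ ≤ 2 * √n := fun t ht => not_lt.1 (h1 t (Nat.lt_succ_of_le ht))
    have hcoh := coherence_qr_le (Z := Z s ω) hn hk0 hU hτ hτ1 hν hG hYdec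
      (by linarith) hs1 hμ (h1' s le_rfl) (h2 (h1' s le_rfl)) (fun i => (h3 i).le) (hqr _)
    obtain ⟨T, X', H, hout, hT, hX', hH⟩ := exists_smoothQROutputs qr Y ε (fun t => Z t ω) hn0 hε
      hs1 hhi (by positivity) h1' hcoh
    refine ⟨T, X', H, hout, le_trans ?_ hsL, hX', hH⟩
    exact_mod_cast hT
  refine (measure_mono hsub).trans ?_
  refine le_trans ?_ (ENNReal.ofReal_le_ofReal (failure_bound_arith hn hkn (by linarith)))
  rw [ENNReal.ofReal_add (by positivity) (by positivity),
    ENNReal.ofReal_add (by positivity) (by positivity)]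
  refine (measure_union_le _ _).trans (add_le_add ((measure_union_le _ _).trans
    (add_le_add ?_ ?_)) ?_)
  · refine (measure_biUnion_finset_le _ _).trans ((Finset.sum_le_card_nsmul _ _ _ fun t _ =>
      (measure_gaussianSamples_le hZ t _).trans
        (gaussianRows_opNorm_tail (by positivity) hgrid)).trans (le_of_eq ?_))
    rw [nsmul_eq_mul, Finset.card_range, ← ENNReal.ofReal_natCast,
      ← ENNReal.ofReal_mul (by positivity)]
    push_cast
    rfl
  · exact (measure_gaussianSamples_le hZ s _).trans (gaussianRows_eucNorm_lower hn hkn' hU hM)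
  · refine (measure_biUnion_finset_le _ _).trans ((Finset.sum_le_card_nsmul _ _ _ fun i _ =>
      (measure_gaussianSamples_le hZ s _).trans (gaussianRows_row_tail i)).trans (le_of_eq ?_))
    rw [nsmul_eq_mul, Finset.card_univ, Fintype.card_fin, ENNReal.ofReal_mul (by positivity),
      ENNReal.ofReal_natCast]
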